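/- Let $\varphi_0, \varphi_1, \dots$ be a standard enumeration of the computable partial functions from $\mathbb{N}$ to $\mathbb{N}$, and let $\mathcal{K} = \{ e \in \mathbb{N} : \varphi_e(e) \text{ is defined} \}$ be the halting set. A function $f$ from $\mathbb{N}$ to the set $\mathfrak{P}_{\mathrm{fin}}(\mathbb{N})$ of finite subsets of $\mathbb{N}$ is called computable if it becomes a computable function $\mathbb{N} \to \mathbb{N}$ when finite sets are identified with natural numbers through a standard effective bijection. A recursively enumerable set $A \subseteq \mathbb{N}$ is called *$d$-complete* (disjunctive complete) if there is a total computable function $f \colon \mathbb{N} \to \mathfrak{P}_{\mathrm{fin}}(\mathbb{N})$ such that for all $e \in \mathbb{N}$ \[ e \in \mathcal{K} \iff \exists z \in f(e)\ [z \in A]. \] For $n \in \mathbb{N}$, it is called *$n$-$d$-complete* if such an $f$ can be chosen with $|f(e)| \leq n$ for all $e \in \mathbb{N}$. **Proposition.** There is a recursively enumerable set $A \subseteq \mathbb{N}$ that is $d$-complete but, for every $n \in \mathbb{N}$, is not $n$-$d$-complete. -/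

import Mathlib

/-- The `e`-th computable partial function `φ_e : ℕ →. ℕ`, in the standard enumeration given by
the Gödel numbering of codes. -/
def phi (e : ℕ) : ℕ →. ℕ :=
  (Denumerable.ofNat Nat.Partrec.Code e).eval

/-- The diagonal halting set `K = {e : φ_e(e) is defined}`. -/
def haltingSet : Set ℕ :=
  {e | (phi e e).Dom}

/-- `A` is `d`-complete (disjunctive complete) via `f`: the set `A` is recursively enumerable,
`f` is a (total) computable function from `ℕ` to the finite subsets of `ℕ`, where finite sets are
coded by natural numbers through the explicit bijection `Finset ℕ ≃ ℕ` of `Denumerable.finset`,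
and `e ∈ K` if and only if `f e` meets `A`. -/
def IsDCompleteVia (A : Set ℕ) (f : ℕ → Finset ℕ) : Prop :=
  REPred (fun x : ℕ => x ∈ A) ∧ Computable f ∧
    ∀ e : ℕ, e ∈ haltingSet ↔ ∃ z ∈ f e, z ∈ A

/-- `A` is `d`-complete (disjunctive complete). -/
def IsDComplete (A : Set ℕ) : Prop :=
  ∃ f : ℕ → Finset ℕ, IsDCompleteVia A f

/-- `A` is `n`-`d`-complete: it is `d`-complete via a function all of whose values have at most
`n` elements. -/
def IsNDComplete (n : ℕ) (A : Set ℕ) : Prop :=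
  ∃ f : ℕ → Finset ℕ, IsDCompleteVia A f ∧ ∀ e : ℕ, (f e).card ≤ n

open Nat.Partrec (Code)
open Nat.Partrec.Code Encodable Denumerable

/-! ### Coding of finite sets by lists -/

/-! When `e` enters the halting set, exactly one number of `block e` enters `sparseComplete`, so
`block` witnesses d-completeness. The freedom within a block serves to defeat reductions `f` with at
most `n` values. Acting is a recursively enumerable event, so a computable `g` reduces it to the
halting set; hence `f (g p)` meets the set iff `p` acts. With `c` a code of `f ∘ g`, the witness `p`
acts once `c` has converged at `p`, the guess `k` has halted and `f (g p)` is still disjoint from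
the set. If `p` never acts, `f (g p)` stays disjoint, so `p` does act. If `p` acts and `k` is the
last index `≤ r` to halt, only indices `e > r` enter afterwards, and `chosen` makes them avoid `f (g
p)`. Both cases are contradictory (`not_isNDComplete_sparseComplete`). -/

theorem lower'_eq_foldl (l : List ℕ) (n : ℕ) (acc : List ℕ) :
    (l.foldl (fun (p : List ℕ × ℕ) m => (p.1 ++ [m - p.2], m + 1)) (acc, n)).1 =
      acc ++ lower' l n := by
  induction l generalizing n acc with
  | nil => simp [lower']
  | cons m l ih => simp [lower', ih]

theorem raise'_eq_foldl (l : List ℕ) (n : ℕ) (acc : List ℕ) :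
    (l.foldl (fun (p : List ℕ × ℕ) m => (p.1 ++ [m + p.2], m + p.2 + 1)) (acc, n)).1 =
      acc ++ raise' l n := by
  induction l generalizing n acc with
  | nil => simp [raise']
  | cons m l ih => simp [raise', ih]

theorem primrec_lower' : Primrec fun l : List ℕ => lower' l 0 := by
  have h : Primrec fun l : List ℕ =>
      (l.foldl (fun (p : List ℕ × ℕ) m => (p.1 ++ [m - p.2], m + 1)) ([], 0)).1 := by
    refine Primrec.fst.comp (Primrec.list_foldl Primrec.id (Primrec.const _)
      (h := fun _ q => (q.1.1 ++ [q.2 - q.1.2], q.2 + 1)) ?_)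
    have hp : Primrec fun x : List ℕ × (List ℕ × ℕ) × ℕ => x.2.1 :=
      Primrec.fst.comp Primrec.snd
    have hm : Primrec fun x : List ℕ × (List ℕ × ℕ) × ℕ => x.2.2 :=
      Primrec.snd.comp Primrec.snd
    exact Primrec.pair (Primrec.list_concat.comp (Primrec.fst.comp hp)
      (Primrec.nat_sub.comp hm (Primrec.snd.comp hp))) (Primrec.succ.comp hm)
  exact h.of_eq fun l => by simp [lower'_eq_foldl]

theorem primrec_raise' : Primrec fun l : List ℕ => raise' l 0 := by
  have h : Primrec fun l : List ℕ =>
      (l.foldl (fun (p : List ℕ × ℕ) m => (p.1 ++ [m + p.2], m + p.2 + 1)) ([], 0)).1 := by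
    refine Primrec.fst.comp (Primrec.list_foldl Primrec.id (Primrec.const _)
      (h := fun _ q => (q.1.1 ++ [q.2 + q.1.2], q.2 + q.1.2 + 1)) ?_)
    have hp : Primrec fun x : List ℕ × (List ℕ × ℕ) × ℕ => x.2.1 :=
      Primrec.fst.comp Primrec.snd
    have hm : Primrec fun x : List ℕ × (List ℕ × ℕ) × ℕ => x.2.2 :=
      Primrec.snd.comp Primrec.snd
    have ha := Primrec.nat_add.comp hm (Primrec.snd.comp hp)
    exact Primrec.pair (Primrec.list_concat.comp (Primrec.fst.comp hp) ha) (Primrec.succ.comp ha)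
  exact h.of_eq fun l => by simp [raise'_eq_foldl]

/-- The increasing list of the elements of the finite set with code `d`. -/
def codedList (d : ℕ) : List ℕ :=
  raise' (ofNat (List ℕ) d) 0

theorem primrec_codedList : Primrec codedList :=
  primrec_raise'.comp (Primrec.ofNat _)

/-- The code of a finite set of natural numbers. -/
def finsetCode (D : Finset ℕ) : ℕ :=
  @encode (Finset ℕ) Denumerable.finset.toEncodable D

theorem finsetCode_eq (D : Finset ℕ) : finsetCode D = encode (lower' D.sort 0) := by
  change encode (lower' (D.map (eqv ℕ).toEmbedding).sort 0) = _
  congr 3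
  ext a
  simp [eqv]

theorem codedList_finsetCode (D : Finset ℕ) : codedList (finsetCode D) = D.sort := by
  rw [codedList, finsetCode_eq, ofNat_encode]
  exact raise_lower' (fun _ _ => Nat.zero_le _) (Finset.sortedLT_sort _)

theorem Computable.finset_of_sort {α : Type*} [Primcodable α] {f : α → Finset ℕ}
    (hf : Computable fun a => (f a).sort) : Computable f := by
  refine Computable.encode_iff.1 ?_
  exact (Computable.encode.comp (primrec_lower'.to_comp.comp hf)).of_eq
    fun a => (finsetCode_eq _).symm

/-! ### Recursively enumerable predicates and the halting set -/

theorem ComputablePred.exists_re {α : Type*} [Primcodable α] {R : α → ℕ → Prop}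
    (hR : ComputablePred fun p : α × ℕ => R p.1 p.2) : REPred fun a => ∃ n, R a n := by
  classical
  have hd := hR.decide
  have : Partrec fun a => Nat.rfind fun n => Part.some (decide (R a n)) :=
    Partrec.rfind hd.partrec
  refine this.dom_re.of_eq fun a => ?_
  refine Nat.rfind_dom.trans ⟨fun ⟨n, hn, _⟩ => ⟨n, ?_⟩, fun ⟨n, hn⟩ => ⟨n, ?_, fun _ => trivial⟩⟩
  · simpa using (Part.mem_some_iff.1 hn).symm
  · exact Part.mem_some_iff.2 (by simpa using hn)

/-- By the s-m-n theorem: the program `curry c x` ignores its input and halts iff `p x`, so it halts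
on its own index iff `p x`. -/
theorem REPred.exists_reduction_haltingSet {p : ℕ → Prop} (hp : REPred p) :
    ∃ g : ℕ → ℕ, Computable g ∧ ∀ x, g x ∈ haltingSet ↔ p x := by
  have h : Partrec fun n : ℕ =>
      (Part.assert (p n.unpair.1) fun _ => Part.some ()).map fun _ => 0 :=
    (hp.comp (Computable.fst.comp Computable.unpair)).map (Computable.const 0).to₂
  obtain ⟨c, hc⟩ := exists_code.1 (Partrec.nat_iff.1 h)
  refine ⟨fun x => encode (curry c x), ?_, fun x => ?_⟩
  · exact Computable.encode.comp
      (primrec₂_curry.to_comp.comp (Computable.const c) Computable.id)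
  · simp [haltingSet, phi, eval_curry, hc, Part.assert]

theorem haltingSet_nonempty : haltingSet.Nonempty :=
  ⟨encode Code.zero, by simp [haltingSet, phi, eval, pure, PFun.pure]⟩

/-- `e` has entered the halting set by stage `t`. -/
def HaltsBy (e t : ℕ) : Prop :=
  (evaln t (ofNat Code e) e).isSome

theorem HaltsBy.mono {e t t' : ℕ} (h : HaltsBy e t) (htt : t ≤ t') : HaltsBy e t' := by
  obtain ⟨y, hy⟩ := Option.isSome_iff_exists.1 h
  exact Option.isSome_iff_exists.2 ⟨y, evaln_mono htt hy⟩

theorem not_haltsBy_zero (e : ℕ) : ¬ HaltsBy e 0 := by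
  simp [HaltsBy, evaln]

theorem mem_haltingSet_iff {e : ℕ} : e ∈ haltingSet ↔ ∃ t, HaltsBy e t := by
  simp only [haltingSet, phi, Set.mem_ofPred_eq, Part.dom_iff_mem, HaltsBy,
    Option.isSome_iff_exists, evaln_complete]
  exact exists_comm

theorem primrec_haltsBy : PrimrecRel HaltsBy := by
  refine PrimrecPred.primrecRel (p := fun q : ℕ × ℕ => HaltsBy q.1 q.2) ?_
  refine Primrec.eq.comp (Primrec.option_isSome.comp (primrec_evaln.comp
    (Primrec.pair (Primrec.pair Primrec.snd ((Primrec.ofNat Code).comp Primrec.fst))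
      Primrec.fst))) (Primrec.const true)

/-- `e` enters the halting set between stages `t` and `t + 1`. -/
def Enters (e t : ℕ) : Prop :=
  HaltsBy e (t + 1) ∧ ¬ HaltsBy e t

theorem primrec_enters : PrimrecRel Enters := by
  refine PrimrecPred.primrecRel (p := fun q : ℕ × ℕ => Enters q.1 q.2) ?_
  exact (primrec_haltsBy.comp Primrec.fst (Primrec.succ.comp Primrec.snd)).and
    (primrec_haltsBy.comp Primrec.fst Primrec.snd).not

theorem mem_haltingSet_iff_enters {e : ℕ} : e ∈ haltingSet ↔ ∃ t, Enters e t := by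
  rw [mem_haltingSet_iff]
  refine ⟨fun h => ?_, fun ⟨t, h⟩ => ⟨_, h.1⟩⟩
  classical
  obtain ⟨t, ht⟩ : ∃ t, Nat.find h = t + 1 := Nat.exists_eq_succ_of_ne_zero fun h0 =>
    not_haltsBy_zero e (h0 ▸ Nat.find_spec h)
  exact ⟨t, ht ▸ Nat.find_spec h, Nat.find_min h (by omega)⟩

/-- Among the elements `≤ r` of the halting set, one enters last. -/
theorem exists_last_to_halt {e₀ r : ℕ} (he : e₀ ∈ haltingSet) (hr : e₀ ≤ r) :
    ∃ k ≤ r, k ∈ haltingSet ∧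
      ∀ e ≤ r, e ∈ haltingSet → ∀ t, HaltsBy k t → HaltsBy e t := by
  classical
  obtain ⟨k, hk, hmax⟩ := ((Finset.range (r + 1)).filter (· ∈ haltingSet)).exists_max_image
    (fun e => sInf {t | HaltsBy e t}) ⟨e₀, by simp [he]; omega⟩
  simp only [Finset.mem_filter, Finset.mem_range, Order.lt_add_one_iff] at hk hmax
  refine ⟨k, hk.1, hk.2, fun e her heK t ht => ?_⟩
  have hne : {t | HaltsBy e t}.Nonempty := mem_haltingSet_iff.1 heK
  exact (Nat.sInf_mem hne : HaltsBy e _).mono ((hmax e ⟨her, heK⟩).trans (Nat.sInf_le ht))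

/-! ### The construction

A requirement `r = ⟨i, n⟩` concerns the `i`-th code. It tests this code at the witnesses `⟨r, k⟩`,
where `k ≤ r` is a guess at the last element `≤ r` to enter the halting set. -/

/-- The first elements of the finite set computed by stage `t` at the witness `p`. -/
def testSet (t p : ℕ) : List ℕ :=
  -- Truncation to `r` elements keeps the restraint bounded for arbitrary codes; a computation that
  -- has not converged restrains nothing.
  (codedList ((evaln t (ofNat Code p.unpair.1.unpair.1) p).getD (finsetCode ∅))).take
    p.unpair.1

/-- The numbers that the requirements below `e` keep out of the set if `e` enters at stage `t`. -/
def restrained (e t : ℕ) : List ℕ :=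
  (List.range e).flatMap fun r => (List.range e).flatMap fun k => testSet t (Nat.pair r k)

/-- The number that enters the set if `e` enters the halting set at stage `t`. -/
def chosen (e t : ℕ) : ℕ :=
  Nat.pair e ((List.range (e * (e * e) + 1)).findIdx
    fun j => decide (Nat.pair e j ∉ restrained e t))

/-- `a` has been enumerated into the constructed set before stage `s`. -/
def EnumBy (s a : ℕ) : Prop :=
  ∃ t < s, Enters a.unpair.1 t ∧ chosen a.unpair.1 t = a

/-- The constructed `d`-complete set. -/
def sparseComplete : Set ℕ :=
  {a | ∃ s, EnumBy s a}

/-- The requirement with witness `p` acts at stage `s`. -/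
def ActsAt (p s : ℕ) : Prop :=
  (evaln s (ofNat Code p.unpair.1.unpair.1) p).isSome ∧ HaltsBy p.unpair.2 s ∧
    ∀ a ∈ testSet s p, ¬ EnumBy s a

theorem length_testSet_le (t p : ℕ) : (testSet t p).length ≤ p.unpair.1 := by
  simp [testSet]

theorem length_flatMap_le {α β : Type*} (l : List α) (f : α → List β) (b : ℕ)
    (h : ∀ a ∈ l, (f a).length ≤ b) : (l.flatMap f).length ≤ l.length * b := by
  induction l with
  | nil => simp
  | cons a l ih =>
    have h₁ := h a (by simp)
    have h₂ := ih fun c hc => h c (by simp [hc])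
    simp only [List.flatMap_cons, List.length_append, List.length_cons]
    linarith

/-- There are `e` choices of `r`, `e` of `k`, and each test set has at most `r < e` elements. A
block of size `e ^ 3 + 1` therefore always has a free element. -/
theorem length_restrained_le (e t : ℕ) : (restrained e t).length ≤ e * (e * e) := by
  refine (length_flatMap_le _ _ (e * e) fun r hr => ?_).trans (by simp)
  refine (length_flatMap_le _ _ e fun k _ => ?_).trans (by simp)
  refine (length_testSet_le _ _).trans ?_
  simpa using (List.mem_range.1 hr).le

theorem exists_free (e t : ℕ) :
    ∃ j < e * (e * e) + 1, Nat.pair e j ∉ restrained e t := by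
  by_contra! h
  have hsub : (Finset.range (e * (e * e) + 1)).image (Nat.pair e) ⊆ (restrained e t).toFinset := by
    intro a ha
    obtain ⟨j, hj, rfl⟩ := Finset.mem_image.1 ha
    exact List.mem_toFinset.2 (h j (Finset.mem_range.1 hj))
  have h₁ := Finset.card_le_card hsub
  rw [Finset.card_image_of_injective _ fun i j hij => (Nat.pair_eq_pair.1 hij).2,
    Finset.card_range] at h₁
  have h₂ := (restrained e t).toFinset_card_le
  have h₃ := length_restrained_le e t
  omega

theorem chosen_spec (e t : ℕ) :
    ∃ j < e * (e * e) + 1, chosen e t = Nat.pair e j ∧ chosen e t ∉ restrained e t := by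
  obtain ⟨j, hj, hfree⟩ := exists_free e t
  have hlt : (List.range (e * (e * e) + 1)).findIdx
      (fun j => decide (Nat.pair e j ∉ restrained e t)) <
        (List.range (e * (e * e) + 1)).length :=
    List.findIdx_lt_length_of_exists ⟨j, List.mem_range.2 hj, by simpa using hfree⟩
  refine ⟨_, by simpa using hlt, rfl, ?_⟩
  have := List.findIdx_getElem (w := hlt)
  simpa [chosen] using this

theorem unpair_chosen_fst (e t : ℕ) : (chosen e t).unpair.1 = e := by
  simp [chosen]

theorem mem_sparseComplete_iff {a : ℕ} :
    a ∈ sparseComplete ↔ ∃ t, Enters a.unpair.1 t ∧ chosen a.unpair.1 t = a :=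
  ⟨fun ⟨_, t, _, h⟩ => ⟨t, h⟩, fun ⟨t, h⟩ => ⟨t + 1, t, t.lt_succ_self, h⟩⟩

/-! ### Effectivity of the construction -/

theorem primrec_evaln_witness :
    Primrec₂ fun t p : ℕ => evaln t (ofNat Code p.unpair.1.unpair.1) p :=
  primrec_evaln.comp (Primrec.pair (Primrec.pair Primrec.fst ((Primrec.ofNat Code).comp
    (Primrec.fst.comp (Primrec.unpair.comp (Primrec.fst.comp
      (Primrec.unpair.comp Primrec.snd)))))) Primrec.snd)

theorem primrec_testSet : Primrec₂ testSet :=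
  Primrec.list_take.comp (Primrec.fst.comp (Primrec.unpair.comp Primrec.snd))
    (primrec_codedList.comp (Primrec.option_getD.comp primrec_evaln_witness (Primrec.const _)))

theorem primrec_restrained : Primrec₂ restrained := by
  refine Primrec.list_flatMap (Primrec.list_range.comp Primrec.fst) ?_
  refine Primrec.list_flatMap
    (f := fun x : (ℕ × ℕ) × ℕ => List.range x.1.1)
    (g := fun x k => testSet x.1.2 (Nat.pair x.2 k))
    (Primrec.list_range.comp (Primrec.fst.comp Primrec.fst)) ?_
  exact primrec_testSet.comp (Primrec.snd.comp (Primrec.fst.comp Primrec.fst))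
    (Primrec₂.natPair.comp (Primrec.snd.comp Primrec.fst) Primrec.snd)

theorem primrec_list_mem : PrimrecRel fun (a : ℕ) (l : List ℕ) => a ∈ l := by
  have h : PrimrecRel fun (l : List ℕ) (a : ℕ) => ∃ b ∈ l, b = a :=
    PrimrecRel.exists_mem_list Primrec.eq
  exact (h.comp Primrec.snd Primrec.fst).of_eq fun _ => by simp

theorem primrec_bound : Primrec fun e : ℕ => e * (e * e) + 1 :=
  Primrec.succ.comp (Primrec.nat_mul.comp Primrec.id
    (Primrec.nat_mul.comp Primrec.id Primrec.id))

theorem primrec_chosen : Primrec₂ chosen := by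
  refine Primrec₂.natPair.comp Primrec.fst (Primrec.list_findIdx
    (Primrec.list_range.comp (primrec_bound.comp Primrec.fst)) ?_)
  refine PrimrecPred.decide (p := fun x : (ℕ × ℕ) × ℕ =>
    Nat.pair x.1.1 x.2 ∉ restrained x.1.1 x.1.2) (PrimrecPred.not ?_)
  exact primrec_list_mem.comp
    (Primrec₂.natPair.comp (Primrec.fst.comp Primrec.fst) Primrec.snd)
    (primrec_restrained.comp (Primrec.fst.comp Primrec.fst) (Primrec.snd.comp Primrec.fst))

theorem primrec_entersAs :
    PrimrecRel fun t a : ℕ => Enters a.unpair.1 t ∧ chosen a.unpair.1 t = a := by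
  have hu : Primrec fun q : ℕ × ℕ => q.2.unpair.1 :=
    Primrec.fst.comp (Primrec.unpair.comp Primrec.snd)
  refine PrimrecPred.primrecRel
    (p := fun q : ℕ × ℕ => Enters q.2.unpair.1 q.1 ∧ chosen q.2.unpair.1 q.1 = q.2) ?_
  exact (primrec_enters.comp hu Primrec.fst).and
    (Primrec.eq.comp (primrec_chosen.comp hu Primrec.fst) Primrec.snd)

theorem primrec_enumBy : PrimrecRel EnumBy :=
  primrec_entersAs.exists_lt

theorem primrec_actsAt : PrimrecRel ActsAt := by
  refine PrimrecPred.primrecRel (p := fun q : ℕ × ℕ => ActsAt q.1 q.2) ?_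
  refine PrimrecPred.and ?_ (PrimrecPred.and ?_ ?_)
  · exact Primrec.eq.comp (Primrec.option_isSome.comp
      (primrec_evaln_witness.comp Primrec.snd Primrec.fst)) (Primrec.const true)
  · exact primrec_haltsBy.comp (Primrec.snd.comp (Primrec.unpair.comp Primrec.fst)) Primrec.snd
  · have h : PrimrecRel fun a s : ℕ => ¬ EnumBy s a :=
      (primrec_enumBy.comp Primrec.snd Primrec.fst).not.primrecRel
    exact h.forall_mem_list.comp (primrec_testSet.comp Primrec.snd Primrec.fst) Primrec.snd

theorem re_sparseComplete : REPred fun a => a ∈ sparseComplete := by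
  refine ComputablePred.exists_re (R := fun a s => EnumBy s a) ?_
  exact (primrec_enumBy.comp Primrec.snd Primrec.fst).computablePred

theorem re_exists_actsAt : REPred fun p => ∃ s, ActsAt p s :=
  ComputablePred.exists_re (primrec_actsAt.comp Primrec.fst Primrec.snd).computablePred

/-! ### `d`-completeness -/

/-- The block of numbers reserved for `e`. -/
def block (e : ℕ) : Finset ℕ :=
  (Finset.range (e * (e * e) + 1)).image (Nat.pair e)

theorem sort_block (e : ℕ) :
    (block e).sort = (List.range (e * (e * e) + 1)).map (Nat.pair e) := by
  have hs : ((List.range (e * (e * e) + 1)).map (Nat.pair e)).Pairwise (· < ·) :=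
    List.pairwise_map.2 (List.pairwise_lt_range.imp fun h => Nat.pair_lt_pair_right e h)
  have : block e = ((List.range (e * (e * e) + 1)).map (Nat.pair e)).toFinset := by
    ext a
    simp [block]
  rw [this]
  exact (List.toFinset_sort (· ≤ ·) (hs.imp ne_of_lt)).2 (hs.imp le_of_lt)

theorem computable_block : Computable block := by
  refine Computable.finset_of_sort (Computable.of_eq ?_ fun e => (sort_block e).symm)
  exact (Primrec.list_map (Primrec.list_range.comp primrec_bound) Primrec₂.natPair).to_comp

theorem isDComplete_sparseComplete : IsDComplete sparseComplete := by
  refine ⟨block, re_sparseComplete, computable_block, fun e => ?_⟩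
  rw [mem_haltingSet_iff_enters]
  constructor
  · rintro ⟨t, ht⟩
    obtain ⟨j, hj, hc, -⟩ := chosen_spec e t
    refine ⟨chosen e t, ?_, mem_sparseComplete_iff.2 ⟨t, ?_⟩⟩
    · exact Finset.mem_image.2 ⟨j, Finset.mem_range.2 hj, hc.symm⟩
    · rw [unpair_chosen_fst]
      exact ⟨ht, rfl⟩
  · rintro ⟨z, hz, hzA⟩
    obtain ⟨j, -, rfl⟩ := Finset.mem_image.1 hz
    obtain ⟨t, ht, -⟩ := mem_sparseComplete_iff.1 hzA
    exact ⟨t, by simpa using ht⟩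

/-! ### No bounded reduction -/

theorem testSet_eq_sort {s p : ℕ} {D : Finset ℕ} (hcard : D.card ≤ p.unpair.1)
    (h : finsetCode D ∈ evaln s (ofNat Code p.unpair.1.unpair.1) p) : testSet s p = D.sort := by
  rw [testSet, Option.mem_def.1 h, Option.getD_some, codedList_finsetCode,
    List.take_of_length_le (by simpa using hcard)]

theorem not_isNDComplete_sparseComplete (n : ℕ) : ¬ IsNDComplete n sparseComplete := by
  rintro ⟨f, ⟨-, hf, hred⟩, hcard⟩
  obtain ⟨g, hg, hgK⟩ := re_exists_actsAt.exists_reduction_haltingSet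
  obtain ⟨c, hc⟩ := exists_code.1
    (Partrec.nat_iff.1 (Computable.encode.comp (hf.comp hg)).partrec)
  obtain ⟨e₀, he₀⟩ := haltingSet_nonempty
  -- Padding by `n` makes truncation harmless; padding by `e₀` ensures that some index `≤ r` halts,
  -- so that a last one exists.
  set r := Nat.pair (encode c) (max n e₀)
  have hr : max n e₀ ≤ r := Nat.right_le_pair _ _
  obtain ⟨k, hkr, hkK, hlast⟩ := exists_last_to_halt he₀ ((le_max_right n e₀).trans hr)
  set p := Nat.pair r k
  have hpr : p.unpair.1 = r := by simp [p]
  have hpk : p.unpair.2 = k := by simp [p]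
  have hcode : ofNat Code p.unpair.1.unpair.1 = c := by simp [hpr, r]
  have hcardp : (f (g p)).card ≤ p.unpair.1 :=
    (hcard _).trans (hpr ▸ (le_max_left n e₀).trans hr)
  have heval : finsetCode (f (g p)) ∈ eval c p := by rw [hc]; exact Part.mem_some (finsetCode (f (g p)))
  have hiff : (∃ s, ActsAt p s) ↔ ∃ z ∈ f (g p), z ∈ sparseComplete :=
    (hgK p).symm.trans (hred (g p))
  obtain ⟨s₀, hs₀⟩ := evaln_complete.1 heval
  by_cases hact : ∃ s, ActsAt p s
  · obtain ⟨z, hz, hzA⟩ := hiff.1 hact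
    obtain ⟨s, hconv, hks, hfree⟩ := hact
    have hval : finsetCode (f (g p)) ∈ evaln s c p := by
      rw [hcode] at hconv
      obtain ⟨y, hy⟩ := Option.isSome_iff_exists.1 hconv
      rwa [Part.mem_unique heval (evaln_sound hy)]
    have htest : ∀ t, s ≤ t → testSet t p = (f (g p)).sort := fun t ht =>
      testSet_eq_sort hcardp (by rw [hcode]; exact evaln_mono ht hval)
    obtain ⟨t, ht, hzt⟩ := mem_sparseComplete_iff.1 hzA
    -- No element of `f (g p)` had been enumerated when `p` acted.
    have hst : s ≤ t := by
      by_contra hlt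
      exact hfree z (by simpa [htest s le_rfl] using hz) ⟨t, not_le.1 hlt, ht, hzt⟩
    -- Since `k` has halted by stage `s`, every index `≤ r` in the halting set has too, and none can
    -- enter at `t ≥ s`.
    have hre : r < z.unpair.1 := by
      by_contra hle
      rw [hpk] at hks
      exact ht.2 ((hlast _ (not_lt.1 hle) (mem_haltingSet_iff.2 ⟨_, ht.1⟩) s hks).mono hst)
    obtain ⟨-, -, -, hnot⟩ := chosen_spec z.unpair.1 t
    refine hnot ?_
    rw [hzt]
    refine List.mem_flatMap.2 ⟨r, List.mem_range.2 hre, List.mem_flatMap.2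
      ⟨k, List.mem_range.2 (hkr.trans_lt hre), ?_⟩⟩
    simpa [p] using (htest t hst).symm ▸ (Finset.mem_sort (· ≤ ·)).2 hz
  -- Without action `f (g p)` misses the set forever, so `p` acts once `c` has converged and `k` has
  -- halted.
  · obtain ⟨s₁, hs₁⟩ := mem_haltingSet_iff.1 hkK
    refine hact ⟨max s₀ s₁, ?_, hpk.symm ▸ hs₁.mono (le_max_right _ _), fun a ha hA => ?_⟩
    · rw [hcode]
      exact Option.isSome_iff_exists.2 ⟨_, evaln_mono (le_max_left _ _) hs₀⟩
    · refine hact (hiff.2 ⟨a, ?_, _, hA⟩)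
      rw [testSet_eq_sort hcardp (by rw [hcode]; exact evaln_mono (le_max_left _ _) hs₀)] at ha
      exact (Finset.mem_sort (· ≤ ·)).1 ha

theorem mainTheorem5 :
    ∃ A : Set ℕ, REPred (fun x : ℕ => x ∈ A) ∧ IsDComplete A ∧ ∀ n : ℕ, ¬ IsNDComplete n A :=
  ⟨sparseComplete, re_sparseComplete, isDComplete_sparseComplete,
    not_isNDComplete_sparseComplete⟩
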